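/- Consider a single-class G/G/1 queue with update packets $k=1,2,\dots$: the inter-arrival times $I_1,I_2,\dots$ are i.i.d. copies of $I$, the service times $X_1,X_2,\dots$ are i.i.d. copies of $X$, all these variables are mutually independent and almost surely positive, $\mathbb E[I^2]<\infty$, $\mathbb E[X^2]<\infty$, and the queue is stable: $\mathbb E[X]<\mathbb E[I]$. Put $\lambda=1/\mathbb E[I]$. Packet $k$ is generated and joins the queue at time $S_k=I_1+\dots+I_k$; packets are served first-come-first-served by one server with unlimited buffer, so packet $k$ is received at time $D_k=\max(D_{k-1},S_k)+X_k$, where $D_0\ge 0$ is an arbitrary (possibly random) initial backlog. The status age at time $t\ge0$ is $\Delta(t)=t-u(t)$, where $u(t)$ is the generation time of the latest packet received by time $t$ (and $u(t)=-a_0$, with $a_0\ge0$ an arbitrary, possibly random, initial age, if no packet has been received by time $t$). Let $A_k=\Delta(D_k^-)$ be the $k$-th peak of the age, i.e. its value just before packet $k$ is received. Then the average age of information and the peak age of information $$A_{av}=\lim_{T\to\infty}\frac1T\int_0^T\Delta(t)\,dt,\qquad A_p=\lim_{K\to\infty}\frac1K\sum_{k=1}^K A_k$$ exist almost surely as finite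 constants that do not depend on the sample path, and $$A_p-\frac{3\lambda\,\mathbb E[I^2]}{2}-\lambda\,\mathbb E[I]^2\;\le\; A_{av}\;\le\; A_p+\frac{\lambda\,\mathbb E[I^2]}{2},$$ where $\mathbb E[I]^2=(\mathbb E[I])^2$. -/

import Mathlib

open MeasureTheory ProbabilityTheory Filter Topology

namespace GG1

/-- The primitive data of a single-class G/G/1 queue: packet `k` arrives `I k` time units after
packet `k - 1` (packet `0` arrives `I 0` time units after time `0`) and requires service `X k`.
The inter-arrival times are i.i.d., the service times are i.i.d., all of them are mutually
independent, and they are almost surely positive. -/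
structure IsInput {Ω : Type*} [MeasurableSpace Ω] (μ : Measure Ω) (I X : ℕ → Ω → ℝ) : Prop where
  measurable_interarrival : ∀ k, Measurable (I k)
  measurable_service : ∀ k, Measurable (X k)
  indep : iIndepFun (Sum.elim I X) μ
  ident_interarrival : ∀ k, IdentDistrib (I k) (I 0) μ μ
  ident_service : ∀ k, IdentDistrib (X k) (X 0) μ μ
  interarrival_pos : ∀ᵐ ω ∂μ, 0 < I 0 ω
  service_pos : ∀ᵐ ω ∂μ, 0 < X 0 ω

/-- Generation (arrival) time of packet `k`, for a path `i` of inter-arrival times. -/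
def arrival (i : ℕ → ℝ) (k : ℕ) : ℝ := ∑ j ∈ Finset.range (k + 1), i j

/-- Reception (departure) time of packet `k` in the work-conserving first-come-first-served
single-server queue with unlimited buffer; the server is busy with the backlog `w₀` found at
time `0` until time `w₀`. A packet enters service once it has arrived and the previous one has
left. -/
noncomputable def departure (w₀ : ℝ) (i x : ℕ → ℝ) : ℕ → ℝ
  | 0 => max w₀ (arrival i 0) + x 0
  | k + 1 => max (departure w₀ i x k) (arrival i (k + 1)) + x (k + 1)

/-- Generation time of the latest update received by time `t`; the update known at time `0` was
generated at time `-a₀`. -/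
noncomputable def lastGenerated (w₀ a₀ : ℝ) (i x : ℕ → ℝ) (t : ℝ) : ℝ :=
  sSup (insert (-a₀) {s : ℝ | ∃ k : ℕ, departure w₀ i x k ≤ t ∧ s = arrival i k})

/-- The status age `Δ(t)`: time elapsed since the latest received update was generated. -/
noncomputable def age (w₀ a₀ : ℝ) (i x : ℕ → ℝ) (t : ℝ) : ℝ :=
  t - lastGenerated w₀ a₀ i x t

/-- The peak of the age that ends with the reception of packet `k`: the value of the age just
before that reception. -/
noncomputable def peak (w₀ a₀ : ℝ) (i x : ℕ → ℝ) (k : ℕ) : ℝ :=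
  Function.leftLim (age w₀ a₀ i x) (departure w₀ i x k)

/-- `a` is the average age `lim_{T → ∞} (1/T) ∫_0^T Δ(t) dt` of the path. -/
def HasAverageAge (w₀ a₀ : ℝ) (i x : ℕ → ℝ) (a : ℝ) : Prop :=
  (∀ T : ℝ, 0 ≤ T → IntervalIntegrable (age w₀ a₀ i x) volume 0 T) ∧
    Tendsto (fun T : ℝ => (1 / T) * ∫ t in (0 : ℝ)..T, age w₀ a₀ i x t) atTop (𝓝 a)

/-- `a` is the average peak age `lim_{K → ∞} (1/K) ∑ A_k` (first `K` peaks) of the path. -/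
def HasPeakAge (w₀ a₀ : ℝ) (i x : ℕ → ℝ) (a : ℝ) : Prop :=
  Tendsto (fun K : ℕ => (1 / (K : ℝ)) * ∑ k ∈ Finset.range K, peak w₀ a₀ i x k) atTop (𝓝 a)

end GG1

/-!
The sojourn times of successive packets follow Lindley's recursion `u' = max (u - I) 0 + X`, driven
by i.i.d. inputs. Reading the inputs backwards makes the recursion from an empty queue increase
along every path; the negative drift bounds its mean through second moments, so it converges to a
stationary sojourn time with finite mean `τ`. Two trajectories with the same input coalesce once
the larger one empties the queue, so the recursion started from its stationary law is ergodic and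
Birkhoff's theorem gives averages that depend neither on the path nor on the initial backlog.

A peak of the age is a sojourn time plus an inter-arrival time, whence `A_p = τ + E[I]`. Between two
receptions the area below the age is `((u' + I) ^ 2 - u ^ 2) / 2`; if `β` is its stationary mean,
then `A_av = β / E[I]`. The squares of `u` and `u'` cancel in the mean, so that
`β = E[u' I] + E[I ^ 2] / 2`, and `u - I + X ≤ u' ≤ u + X` with `u` independent of `(I, X)` puts `β`
within `E[I ^ 2] / 2` of `τ E[I] + E[I X]`.
-/

/-- `L` is the limit of the averages of the first `n` terms of `u`. -/
def HasCesaroMean (u : ℕ → ℝ) (L : ℝ) : Prop :=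
  Tendsto (fun n : ℕ => (∑ k ∈ Finset.range n, u k) / n) atTop (𝓝 L)

lemma tendsto_succ_div_natCast_iff {a : ℕ → ℝ} {L : ℝ} :
    Tendsto (fun n : ℕ => a (n + 1) / n) atTop (𝓝 L) ↔
      Tendsto (fun n : ℕ => a n / n) atTop (𝓝 L) := by
  have hratio : Tendsto (fun n : ℕ => (n : ℝ) / (n + 1)) atTop (𝓝 1) :=
    tendsto_natCast_div_add_atTop 1
  rw [← tendsto_add_atTop_iff_nat (f := fun n : ℕ => a n / n) 1]
  constructor <;> intro h
  · refine (mul_one L ▸ h.mul hratio).congr' ?_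
    filter_upwards [eventually_ne_atTop 0] with n hn
    push_cast
    field_simp
  · refine (div_one L ▸ h.div hratio one_ne_zero).congr' ?_
    filter_upwards [eventually_ne_atTop 0] with n hn
    simp only [Pi.div_apply]
    push_cast
    field_simp

namespace HasCesaroMean

variable {u v : ℕ → ℝ} {L M : ℝ}

lemma add (hu : HasCesaroMean u L) (hv : HasCesaroMean v M) :
    HasCesaroMean (fun n => u n + v n) (L + M) := by
  simpa only [HasCesaroMean, Finset.sum_add_distrib, add_div] using Tendsto.add hu hv

lemma congr' (hu : HasCesaroMean u L) (huv : u =ᶠ[atTop] v) : HasCesaroMean v L := by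
  have hsub : HasCesaroMean (fun n => v n - u n) 0 := by
    have hzero : Tendsto (fun n => v n - u n) atTop (𝓝 0) :=
      tendsto_const_nhds.congr' (huv.mono fun n hn => (sub_eq_zero.2 hn.symm).symm)
    simpa only [HasCesaroMean, div_eq_inv_mul] using hzero.cesaro
  simpa only [add_sub_cancel, add_zero] using hu.add hsub

lemma comp_succ_iff : HasCesaroMean (fun n => u (n + 1)) L ↔ HasCesaroMean u L := by
  have hzero : Tendsto (fun n : ℕ => u 0 / (n : ℝ)) atTop (𝓝 0) :=
    tendsto_const_div_atTop_nhds_zero_nat _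
  rw [HasCesaroMean, HasCesaroMean,
    ← tendsto_succ_div_natCast_iff (a := fun n => ∑ k ∈ Finset.range n, u k)]
  simp only [Finset.sum_range_succ' u, add_div]
  exact ⟨fun h => by simpa using h.add hzero, fun h => by simpa using h.sub hzero⟩

lemma tendsto_div_natCast (hu : HasCesaroMean u L) :
    Tendsto (fun n : ℕ => u n / n) atTop (𝓝 0) := by
  have hsub := (tendsto_succ_div_natCast_iff.2 hu).sub hu
  simpa only [Finset.sum_range_succ, ← sub_div, add_sub_cancel_left, sub_self] using hsub

end HasCesaroMean

section Renewal

variable {D : ℕ → ℝ} {m : ℝ}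

lemma tendsto_atTop_of_tendsto_div_natCast (hm : 0 < m)
    (hD : Tendsto (fun n : ℕ => D n / n) atTop (𝓝 m)) : Tendsto D atTop atTop := by
  refine (hD.pos_mul_atTop hm tendsto_natCast_atTop_atTop).congr' ?_
  filter_upwards [eventually_ne_atTop 0] with n hn
  exact div_mul_cancel₀ _ (Nat.cast_ne_zero.2 hn)

lemma exists_tendsto_atTop_le_lt (hD : Tendsto D atTop atTop) :
    ∃ N : ℝ → ℕ, Tendsto N atTop atTop ∧ ∀ᶠ T in atTop, D (N T) ≤ T ∧ T < D (N T + 1) := by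
  classical
  have hex (T : ℝ) : ∃ n, T < D n := (hD.eventually_gt_atTop T).exists
  have hfind (n : ℕ) : ∀ᶠ T in atTop, n < Nat.find (hex T) := by
    filter_upwards [(Finset.range (n + 1)).eventually_all.2
      fun k _ => eventually_ge_atTop (D k)] with T hT
    exact (Nat.lt_find_iff _ _).2 fun k hk => (hT k (Finset.mem_range_succ_iff.2 hk)).not_gt
  refine ⟨fun T => Nat.find (hex T) - 1, tendsto_atTop.2 fun n => ?_, ?_⟩
  · filter_upwards [hfind n] with T hT using Nat.le_sub_one_of_lt hT
  · filter_upwards [hfind 0] with T hT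
    refine ⟨not_lt.1 (Nat.find_min (hex T) (Nat.sub_one_lt hT.ne')), ?_⟩
    rw [Nat.sub_add_cancel hT]
    exact Nat.find_spec (hex T)

/-- Between two consecutive epochs `G T / T` is squeezed by monotonicity, with bounds that are
asymptotically equal because consecutive epochs are. -/
lemma tendsto_div_of_tendsto_epochs {G : ℝ → ℝ} {β : ℝ} (hm : 0 < m) (hG0 : 0 ≤ G 0)
    (hG : MonotoneOn G (Set.Ici 0)) (hD : Tendsto (fun n : ℕ => D n / n) atTop (𝓝 m))
    (hGD : Tendsto (fun n : ℕ => G (D n) / n) atTop (𝓝 β)) :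
    Tendsto (fun T => G T / T) atTop (𝓝 (β / m)) := by
  have hquot {a b : ℕ → ℝ} (ha : Tendsto (fun n : ℕ => a n / n) atTop (𝓝 β))
      (hb : Tendsto (fun n : ℕ => b n / n) atTop (𝓝 m)) :
      Tendsto (fun n => a n / b n) atTop (𝓝 (β / m)) := by
    refine (ha.div hb hm.ne').congr' ?_
    filter_upwards [eventually_ne_atTop 0] with n hn
    exact div_div_div_cancel_right₀ (Nat.cast_ne_zero.2 hn) _ _
  have hlower : Tendsto (fun n => G (D n) / D (n + 1)) atTop (𝓝 (β / m)) :=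
    hquot hGD (tendsto_succ_div_natCast_iff.2 hD)
  have hupper : Tendsto (fun n => G (D (n + 1)) / D n) atTop (𝓝 (β / m)) :=
    hquot (tendsto_succ_div_natCast_iff (a := fun n => G (D n)).2 hGD) hD
  have hDtop := tendsto_atTop_of_tendsto_div_natCast hm hD
  obtain ⟨N, hN, hND⟩ := exists_tendsto_atTop_le_lt hDtop
  have hpos : ∀ᶠ T in atTop, 0 < D (N T) := (hDtop.comp hN).eventually_gt_atTop 0
  refine tendsto_of_tendsto_of_tendsto_of_le_of_le' (hlower.comp hN) (hupper.comp hN) ?_ ?_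
  · filter_upwards [hND, hpos] with T ⟨hle, hlt⟩ h0
    have hT : 0 < T := h0.trans_le hle
    exact div_le_div₀ (hG0.trans (hG Set.self_mem_Ici hT.le hT.le)) (hG h0.le hT.le hle) hT hlt.le
  · filter_upwards [hND, hpos] with T ⟨hle, hlt⟩ h0
    have hT : 0 < T := h0.trans_le hle
    have hT' : 0 < D (N T + 1) := hT.trans hlt
    exact div_le_div₀ (hG0.trans (hG Set.self_mem_Ici hT'.le hT'.le))
      (hG hT.le hT'.le hlt.le) h0 hle

end Renewal

section PointwiseErgodicTheorem

/-- The maximum of the Birkhoff sums of `f` of orders `0, …, n`, defined by the recursion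
`M (n + 1) = max 0 (f + M n ∘ T)` on which the maximal ergodic argument rests. -/
def maxBirkhoffSum {α : Type*} (T : α → α) (f : α → ℝ) : ℕ → α → ℝ
  | 0 => fun _ => 0
  | n + 1 => fun x => max 0 (f x + maxBirkhoffSum T f n (T x))

variable {α : Type*} {T : α → α} {f : α → ℝ}

lemma maxBirkhoffSum_nonneg (n : ℕ) (x : α) : 0 ≤ maxBirkhoffSum T f n x := by
  cases n with
  | zero => exact le_rfl
  | succ n => exact le_max_left _ _

lemma monotone_maxBirkhoffSum (x : α) : Monotone fun n => maxBirkhoffSum T f n x := by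
  refine monotone_nat_of_le_succ fun n => ?_
  induction n generalizing x with
  | zero => exact maxBirkhoffSum_nonneg 1 x
  | succ n ih => exact max_le_max le_rfl (by gcongr; exact ih (T x))

lemma birkhoffSum_le_maxBirkhoffSum (n : ℕ) (x : α) :
    birkhoffSum T f n x ≤ maxBirkhoffSum T f n x := by
  induction n generalizing x with
  | zero => simp [maxBirkhoffSum]
  | succ n ih =>
    rw [birkhoffSum_succ']
    exact le_max_of_le_right (by gcongr; exact ih (T x))

lemma bddAbove_maxBirkhoffSum_comp_iff (x : α) :
    BddAbove (Set.range fun n => maxBirkhoffSum T f n (T x)) ↔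
      BddAbove (Set.range fun n => maxBirkhoffSum T f n x) := by
  constructor <;> rintro ⟨C, hC⟩ <;> rw [mem_upperBounds, Set.forall_mem_range] at hC
  · refine ⟨max 0 (f x + C), Set.forall_mem_range.2 fun n => ?_⟩
    exact (monotone_maxBirkhoffSum x n.le_succ).trans (max_le_max le_rfl (by gcongr; exact hC n))
  · exact ⟨C - f x, Set.forall_mem_range.2 fun n =>
      le_sub_iff_add_le'.2 ((le_max_right _ _).trans (hC (n + 1)))⟩

lemma abs_maxBirkhoffSum_succ_sub_comp_le (n : ℕ) (x : α) :
    |maxBirkhoffSum T f (n + 1) x - maxBirkhoffSum T f n (T x)| ≤ |f x| := by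
  have hnonneg : 0 ≤ maxBirkhoffSum T f n (T x) := maxBirkhoffSum_nonneg n (T x)
  rw [maxBirkhoffSum, abs_sub_le_iff, sub_le_iff_le_add, sub_le_comm]
  exact ⟨max_le (by positivity) (by gcongr; exact le_abs_self _),
    le_max_of_le_right (by linarith [neg_abs_le (f x)])⟩

lemma tendsto_maxBirkhoffSum_succ_sub_comp {x : α}
    (hx : ¬ BddAbove (Set.range fun n => maxBirkhoffSum T f n x)) :
    Tendsto (fun n => maxBirkhoffSum T f (n + 1) x - maxBirkhoffSum T f n (T x)) atTop
      (𝓝 (f x)) := by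
  rw [← bddAbove_maxBirkhoffSum_comp_iff] at hx
  have htop := tendsto_atTop_atTop_of_monotone' (monotone_maxBirkhoffSum (T x)) hx
  refine tendsto_const_nhds.congr' ?_
  filter_upwards [htop.eventually_ge_atTop (-f x)] with n hn
  have hmax : maxBirkhoffSum T f (n + 1) x = f x + maxBirkhoffSum T f n (T x) :=
    max_eq_right (by linarith)
  rw [hmax, add_sub_cancel_right]

lemma eventually_birkhoffAverage_lt {q c : ℝ} (hqc : q < c) {x : α}
    (hx : BddAbove (Set.range fun n => birkhoffSum T (fun y => f y - q) n x)) :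
    ∀ᶠ n in atTop, birkhoffAverage ℝ T f n x < c := by
  obtain ⟨C, hC⟩ := hx
  have hlim : Tendsto (fun n : ℕ => C / (n : ℝ)) atTop (𝓝 0) :=
    tendsto_const_div_atTop_nhds_zero_nat C
  filter_upwards [hlim.eventually_lt_const (sub_pos.2 hqc), eventually_gt_atTop 0] with n hn hn0
  have hsum : birkhoffSum T f n x - n * q ≤ C := by
    simpa [birkhoffSum, Finset.sum_sub_distrib] using hC ⟨n, rfl⟩
  have hn' : (0 : ℝ) < n := Nat.cast_pos.2 hn0
  rw [div_lt_iff₀ hn'] at hn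
  rw [birkhoffAverage, smul_eq_mul, inv_mul_lt_iff₀ hn']
  linarith

variable [MeasurableSpace α] {μ : Measure α}

lemma measurable_maxBirkhoffSum (hT : Measurable T) (hf : Measurable f) (n : ℕ) :
    Measurable (maxBirkhoffSum T f n) := by
  induction n with
  | zero => exact measurable_const
  | succ n ih => exact measurable_const.max (hf.add (ih.comp hT))

lemma integrable_maxBirkhoffSum (hT : MeasurePreserving T μ μ) (hf : Integrable f μ) (n : ℕ) :
    Integrable (maxBirkhoffSum T f n) μ := by
  induction n with
  | zero => exact integrable_zero _ _ _
  | succ n ih => exact (integrable_zero _ _ _).sup (hf.add (hT.integrable_comp_of_integrable ih))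

lemma integral_nonneg_of_ae_not_bddAbove_maxBirkhoffSum (hT : MeasurePreserving T μ μ)
    (hf : Integrable f μ) (hub : ∀ᵐ x ∂μ, ¬ BddAbove (Set.range fun n => maxBirkhoffSum T f n x)) :
    0 ≤ ∫ x, f x ∂μ := by
  have hM := integrable_maxBirkhoffSum hT hf
  have hMT (n : ℕ) : Integrable (fun x => maxBirkhoffSum T f n (T x)) μ :=
    hT.integrable_comp_of_integrable (hM n)
  have hlim : Tendsto (fun n => ∫ x, (maxBirkhoffSum T f (n + 1) x - maxBirkhoffSum T f n (T x)) ∂μ)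
      atTop (𝓝 (∫ x, f x ∂μ)) :=
    tendsto_integral_of_dominated_convergence (fun x => |f x|)
      (fun n => ((hM _).sub (hMT n)).aestronglyMeasurable) hf.abs
      (fun n => ae_of_all _ fun x => abs_maxBirkhoffSum_succ_sub_comp_le n x)
      (hub.mono fun x hx => tendsto_maxBirkhoffSum_succ_sub_comp hx)
  refine ge_of_tendsto' hlim fun n => ?_
  have hinv : ∫ x, maxBirkhoffSum T f n (T x) ∂μ = ∫ x, maxBirkhoffSum T f n x ∂μ :=
    hT.hasLaw.integral_comp (hM n).aestronglyMeasurable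
  rw [integral_sub (hM _) (hMT n), hinv, sub_nonneg]
  exact integral_mono (hM n) (hM _) fun x => monotone_maxBirkhoffSum x n.le_succ

lemma ae_bddAbove_birkhoffSum (hT : Ergodic T μ) (hfm : Measurable f) (hf : Integrable f μ)
    (hneg : ∫ x, f x ∂μ < 0) :
    ∀ᵐ x ∂μ, BddAbove (Set.range fun n => birkhoffSum T f n x) := by
  have hmeas : MeasurableSet {x | BddAbove (Set.range fun n => maxBirkhoffSum T f n x)} :=
    measurableSet_bddAbove_range fun n => measurable_maxBirkhoffSum hT.measurable hfm n
  rcases hT.ae_mem_or_ae_notMem hmeas (Set.ext bddAbove_maxBirkhoffSum_comp_iff) with h | h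
  · filter_upwards [h] with x hx
    exact hx.range_mono _ fun n => birkhoffSum_le_maxBirkhoffSum n x
  · exact absurd (integral_nonneg_of_ae_not_bddAbove_maxBirkhoffSum hT.toMeasurePreserving hf h)
      hneg.not_ge

variable [IsProbabilityMeasure μ]

lemma ae_eventually_birkhoffAverage_lt (hT : Ergodic T μ) (hfm : Measurable f)
    (hf : Integrable f μ) :
    ∀ᵐ x ∂μ, ∀ c, ∫ y, f y ∂μ < c → ∀ᶠ n in atTop, birkhoffAverage ℝ T f n x < c := by
  have hbdd : ∀ᵐ x ∂μ, ∀ q : ℚ, ∫ y, f y ∂μ < q →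
      BddAbove (Set.range fun n => birkhoffSum T (fun y => f y - q) n x) := by
    refine ae_all_iff.2 fun q => eventually_imp_distrib_left.2 fun hq => ?_
    refine ae_bddAbove_birkhoffSum hT (hfm.sub_const _) (hf.sub (integrable_const _)) ?_
    rw [integral_sub hf (integrable_const _)]
    simpa using hq
  filter_upwards [hbdd] with x hx c hc
  obtain ⟨q, hq, hqc⟩ := exists_rat_btwn hc
  exact eventually_birkhoffAverage_lt hqc (hx q hq)

/-- **Birkhoff's pointwise ergodic theorem** for ergodic maps. -/
theorem ae_tendsto_birkhoffAverage (hT : Ergodic T μ) (hf : Integrable f μ) :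
    ∀ᵐ x ∂μ, Tendsto (fun n => birkhoffAverage ℝ T f n x) atTop (𝓝 (∫ y, f y ∂μ)) := by
  wlog hfm : Measurable f generalizing f
  · have hmk := hf.1.ae_eq_mk
    have heq := ae_all_iff.2 fun n =>
      hT.quasiMeasurePreserving.birkhoffAverage_ae_eq_of_ae_eq ℝ hmk n
    rw [integral_congr_ae hmk]
    filter_upwards [this (hf.congr hmk) hf.1.measurable_mk, heq] with x hx heqx
    exact hx.congr fun n => (heqx n).symm
  filter_upwards [ae_eventually_birkhoffAverage_lt hT hfm hf,
    ae_eventually_birkhoffAverage_lt hT hfm.neg hf.neg] with x hupper hlower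
  refine tendsto_order.2 ⟨fun c hc => ?_, hupper⟩
  filter_upwards [hlower (-c) (by rw [integral_neg']; exact neg_lt_neg hc)] with n hn
  rw [birkhoffAverage_neg] at hn
  exact neg_lt_neg_iff.1 hn

end PointwiseErgodicTheorem

section Integration

variable {α : Type*} [MeasurableSpace α] {μ : Measure α}

/-- Neither function need be integrable; truncating both reduces to the integrable case. -/
lemma integral_sub_eq_zero_of_identDistrib [IsFiniteMeasure μ] {X Y : α → ℝ}
    (h : IdentDistrib X Y μ μ) (hint : Integrable (fun x => X x - Y x) μ) :
    ∫ x, (X x - Y x) ∂μ = 0 := by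
  let clip (n : ℕ) (a : ℝ) : ℝ := max (min a n) (-n)
  have hlip (n : ℕ) : LipschitzWith 1 (clip n) := (LipschitzWith.id.min_const _).max_const _
  have hclip (n : ℕ) {Z : α → ℝ} (hZ : AEMeasurable Z μ) : Integrable (fun x => clip n (Z x)) μ :=
    .of_bound ((hlip n).continuous.measurable.comp_aemeasurable hZ).aestronglyMeasurable n <|
      ae_of_all _ fun x => abs_le.2 ⟨le_max_right _ _,
        max_le (min_le_right _ _) (neg_le_self n.cast_nonneg)⟩
  have hzero (n : ℕ) : ∫ x, (clip n (X x) - clip n (Y x)) ∂μ = 0 := by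
    rw [integral_sub (hclip n h.aemeasurable_fst) (hclip n h.aemeasurable_snd), sub_eq_zero]
    exact (h.comp (hlip n).continuous.measurable).integral_eq
  have hev (a : ℝ) : ∀ᶠ n in atTop, clip n a = a := by
    filter_upwards [tendsto_natCast_atTop_atTop.eventually_ge_atTop |a|] with n hn
    rw [abs_le] at hn
    simp only [clip, min_eq_left hn.2, max_eq_left hn.1]
  have hlim : Tendsto (fun n => ∫ x, (clip n (X x) - clip n (Y x)) ∂μ) atTop
      (𝓝 (∫ x, (X x - Y x) ∂μ)) := by
    refine tendsto_integral_of_dominated_convergence (fun x => |X x - Y x|) (fun n =>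
      ((hclip n h.aemeasurable_fst).sub (hclip n h.aemeasurable_snd)).aestronglyMeasurable)
      hint.abs (fun n => ae_of_all _ fun x => ?_) (ae_of_all _ fun x => ?_)
    · simpa [Real.dist_eq] using (hlip n).dist_le_mul (X x) (Y x)
    · refine tendsto_const_nhds.congr' ?_
      filter_upwards [hev (X x), hev (Y x)] with n hX hY
      rw [hX, hY]
  simp_rw [hzero] at hlim
  exact tendsto_nhds_unique hlim tendsto_const_nhds

variable {f : ℕ → α → ℝ} {C : ℝ}

lemma lintegral_iSup_ofReal_lt_top (hf : ∀ n, Integrable (f n) μ) (hf0 : 0 ≤ᵐ[μ] f 0)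
    (hmono : ∀ᵐ x ∂μ, Monotone fun n => f n x) (hC : ∀ n, ∫ x, f n x ∂μ ≤ C) :
    ∫⁻ x, ⨆ n, ENNReal.ofReal (f n x) ∂μ < ⊤ := by
  rw [lintegral_iSup' (fun n => (hf n).aemeasurable.ennreal_ofReal)
    (hmono.mono fun x hx => ENNReal.ofReal_mono.comp hx)]
  refine (iSup_le fun n => ?_).trans_lt (ENNReal.ofReal_lt_top (r := C))
  rw [← ofReal_integral_eq_lintegral_ofReal (hf n)
    (by filter_upwards [hf0, hmono] with x h0 hx using h0.trans (hx n.zero_le))]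
  exact ENNReal.ofReal_le_ofReal (hC n)

lemma ae_tendsto_iSup_of_integral_le (hf : ∀ n, Integrable (f n) μ) (hf0 : 0 ≤ᵐ[μ] f 0)
    (hmono : ∀ᵐ x ∂μ, Monotone fun n => f n x) (hC : ∀ n, ∫ x, f n x ∂μ ≤ C) :
    ∀ᵐ x ∂μ, Tendsto (fun n => f n x) atTop (𝓝 (⨆ n, f n x)) := by
  filter_upwards [hmono, ae_lt_top' (.iSup fun n => (hf n).aemeasurable.ennreal_ofReal)
    (lintegral_iSup_ofReal_lt_top hf hf0 hmono hC).ne] with x hx hfin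
  refine tendsto_atTop_ciSup hx ⟨(⨆ n, ENNReal.ofReal (f n x)).toReal,
    Set.forall_mem_range.2 fun n => ?_⟩
  exact (ENNReal.ofReal_le_iff_le_toReal hfin.ne).1 (le_iSup (fun n => ENNReal.ofReal (f n x)) n)

lemma integrable_iSup_of_integral_le (hf : ∀ n, Integrable (f n) μ) (hf0 : 0 ≤ᵐ[μ] f 0)
    (hmono : ∀ᵐ x ∂μ, Monotone fun n => f n x) (hC : ∀ n, ∫ x, f n x ∂μ ≤ C) :
    Integrable (fun x => ⨆ n, f n x) μ := by
  have hlim := ae_tendsto_iSup_of_integral_le hf hf0 hmono hC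
  refine ⟨aestronglyMeasurable_of_tendsto_ae _ (fun n => (hf n).1) hlim, ?_⟩
  rw [hasFiniteIntegral_iff_ofReal]
  · refine (lintegral_mono_ae ?_).trans_lt (lintegral_iSup_ofReal_lt_top hf hf0 hmono hC)
    filter_upwards [hlim] with x hx
    exact le_of_tendsto' ((ENNReal.continuous_ofReal.tendsto _).comp hx)
      fun n => le_iSup (fun n => ENNReal.ofReal (f n x)) n
  · filter_upwards [hf0, hmono, hlim] with x h0 hx hlimx
    exact h0.trans (hx.ge_of_tendsto hlimx 0)

end Integration

section IIDSequences

variable {E : Type*}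

/-- The one-sided shift on sequences. -/
def seqShift (ω : ℕ → E) : ℕ → E := fun n => ω (n + 1)

lemma seqShift_iterate_apply (n k : ℕ) (ω : ℕ → E) : seqShift^[n] ω k = ω (k + n) := by
  induction n generalizing k with
  | zero => rfl
  | succ n ih => rw [Function.iterate_succ_apply', seqShift, ih, add_right_comm, add_assoc]

variable [MeasurableSpace E]

lemma measurable_seqShift : Measurable (seqShift : (ℕ → E) → ℕ → E) :=
  measurable_pi_lambda _ fun n => measurable_pi_apply (n + 1)

/-- The law of a sequence of independent variables of law `ν`. -/
noncomputable abbrev iidLaw (ν : Measure E) : Measure (ℕ → E) := Measure.infinitePi fun _ => ν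

variable (ν : Measure E) [IsProbabilityMeasure ν]

lemma measurePreserving_seqShift : MeasurePreserving seqShift (iidLaw ν) (iidLaw ν) where
  measurable := measurable_seqShift
  map_eq := Measure.map_infinitePi_infinitePi_of_inj (P := fun _ : ℕ => ν) Nat.succ_injective

lemma measurePreserving_eval_iidLaw (n : ℕ) :
    MeasurePreserving (fun ω : ℕ → E => ω n) (iidLaw ν) ν :=
  measurePreserving_eval_infinitePi (fun _ : ℕ => ν) n

lemma iIndep_comap_eval_iidLaw :
    iIndep (fun n => MeasurableSpace.comap (fun ω : ℕ → E => ω n) inferInstance) (iidLaw ν) :=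
  iIndepFun.iIndep (iIndepFun_infinitePi (P := fun _ : ℕ => ν) (X := fun _ x => x)
    fun _ => measurable_id)

lemma indepFun_seqShift_eval_zero : IndepFun seqShift (fun ω : ℕ → E => ω 0) (iidLaw ν) := by
  have h := indep_iSup_of_disjoint (S := {n | 1 ≤ n}) (T := {0})
    (fun n => (measurable_pi_apply n).comap_le) (iIndep_comap_eval_iidLaw ν) (by simp)
  refine indep_of_indep_of_le_left (indep_of_indep_of_le_right h ?_) ?_
  · exact le_iSup₂_of_le 0 rfl le_rfl
  · rw [MeasurableSpace.pi, MeasurableSpace.comap_iSup]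
    refine iSup_le fun n => ?_
    rw [MeasurableSpace.comap_comp]
    exact le_iSup₂_of_le (n + 1) (by simp) le_rfl

lemma measurePreserving_seqShift_eval_zero :
    MeasurePreserving (fun ω : ℕ → E => (seqShift ω, ω 0)) (iidLaw ν) ((iidLaw ν).prod ν) where
  measurable := measurable_seqShift.prodMk (measurable_pi_apply 0)
  map_eq := by
    rw [(indepFun_iff_map_prod_eq_prod_map_map measurable_seqShift.aemeasurable
      (measurable_pi_apply 0).aemeasurable).1 (indepFun_seqShift_eval_zero ν),
      (measurePreserving_seqShift ν).map_eq, (measurePreserving_eval_iidLaw ν 0).map_eq]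

lemma ergodic_seqShift : Ergodic seqShift (iidLaw ν) := by
  refine ⟨measurePreserving_seqShift ν, ⟨fun s hs hinv => ?_⟩⟩
  have htail : MeasurableSet[limsup
      (fun n => MeasurableSpace.comap (fun ω : ℕ → E => ω n) inferInstance) atTop] s := by
    rw [limsup_eq_iInf_iSup_of_nat, MeasurableSpace.measurableSet_iInf]
    intro n
    have hmeas : Measurable[⨆ i ≥ n, MeasurableSpace.comap (fun ω : ℕ → E => ω i) inferInstance]
        (seqShift^[n] : (ℕ → E) → ℕ → E) := by
      refine @measurable_pi_lambda _ _ _ (_) _ _ fun k => ?_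
      simp_rw [seqShift_iterate_apply]
      exact (comap_measurable (fun ω : ℕ → E => ω (k + n))).mono
        (le_iSup₂_of_le (k + n) (Nat.le_add_left n k) le_rfl) le_rfl
    have hn : seqShift^[n] ⁻¹' s = s := by
      rw [Set.preimage_iterate_eq]
      exact Function.iterate_fixed hinv n
    exact hn ▸ hmeas hs
  rw [eventuallyConst_set']
  exact (measure_zero_or_one_of_measurableSet_limsup_atTop
    (fun n => (measurable_pi_apply n).comap_le) (iIndep_comap_eval_iidLaw ν) htail).imp
    ae_eq_empty.2 fun h => ae_eq_univ.2 ((prob_compl_eq_zero_iff hs).2 h)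

lemma ae_hasCesaroMean_iidLaw {f : E → ℝ} (hf : Integrable f ν) :
    ∀ᵐ ω ∂(iidLaw ν), HasCesaroMean (fun k => f (ω k)) (∫ e, f e ∂ν) := by
  have heval := measurePreserving_eval_iidLaw ν 0
  filter_upwards [ae_tendsto_birkhoffAverage (ergodic_seqShift ν)
    (heval.integrable_comp_of_integrable hf)] with ω hω
  rw [show ∫ ω, (f ∘ fun ω : ℕ → E => ω 0) ω ∂(iidLaw ν) = ∫ e, f e ∂ν from
    heval.hasLaw.integral_comp hf.aestronglyMeasurable] at hω
  simpa [HasCesaroMean, birkhoffAverage, birkhoffSum, seqShift_iterate_apply, div_eq_inv_mul]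
    using hω

end IIDSequences

section DrivenRecursions

variable {S E : Type*}

/-- The trajectory from `s` of the recursion `u (n + 1) = φ (u n) (ω n)` driven by `ω`. -/
def drivenOrbit (φ : S → E → S) (s : S) (ω : ℕ → E) : ℕ → S
  | 0 => s
  | n + 1 => φ (drivenOrbit φ s ω n) (ω n)

/-- The driven recursion as a dynamical system on pairs (state, future input). -/
def skewShift (φ : S → E → S) (p : S × (ℕ → E)) : S × (ℕ → E) := (φ p.1 (p.2 0), seqShift p.2)

/-- Any two trajectories driven by `ω` meet, and therefore agree from then on. -/
def Coalesces (φ : S → E → S) (ω : ℕ → E) : Prop :=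
  ∀ s t, ∃ n, drivenOrbit φ s ω n = drivenOrbit φ t ω n

variable {φ : S → E → S}

lemma skewShift_iterate (s : S) (ω : ℕ → E) (n : ℕ) :
    (skewShift φ)^[n] (s, ω) = (drivenOrbit φ s ω n, seqShift^[n] ω) := by
  induction n with
  | zero => rfl
  | succ n ih =>
    simp only [Function.iterate_succ_apply', ih, skewShift, drivenOrbit, seqShift_iterate_apply,
      zero_add]

lemma Coalesces.eventually_eq {ω : ℕ → E} (h : Coalesces φ ω) (s t : S) :
    ∀ᶠ n in atTop, drivenOrbit φ s ω n = drivenOrbit φ t ω n := by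
  obtain ⟨m, hm⟩ := h s t
  filter_upwards [eventually_ge_atTop m] with n hn
  induction n, hn using Nat.le_induction with
  | base => exact hm
  | succ n _ ih => rw [drivenOrbit, drivenOrbit, ih]

variable [MeasurableSpace S] [MeasurableSpace E] {π : Measure S} [IsProbabilityMeasure π]
  {ν : Measure E} [IsProbabilityMeasure ν]

lemma measurePreserving_skewShift
    (hπ : MeasurePreserving (fun p : S × E => φ p.1 p.2) (π.prod ν) π) :
    MeasurePreserving (skewShift φ) (π.prod (iidLaw ν)) (π.prod (iidLaw ν)) :=
  (hπ.prod (MeasurePreserving.id _)).comp <| (measurePreserving_prodAssoc π ν (iidLaw ν)).symm.comp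
    ((MeasurePreserving.id π).prod
      (Measure.measurePreserving_swap.comp (measurePreserving_seqShift_eval_zero ν)))

/-- By coalescence an invariant set does not depend on the state, so it is, up to a null set, an
invariant set of the shift. -/
lemma ergodic_skewShift (hπ : MeasurePreserving (fun p : S × E => φ p.1 p.2) (π.prod ν) π)
    (hco : ∀ᵐ ω ∂(iidLaw ν), Coalesces φ ω) : Ergodic (skewShift φ) (π.prod (iidLaw ν)) := by
  refine ⟨measurePreserving_skewShift hπ, ⟨fun s hs hinv => ?_⟩⟩
  have hiter (n : ℕ) (p : S × (ℕ → E)) : (skewShift φ)^[n] p ∈ s ↔ p ∈ s := by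
    have hn : (skewShift φ)^[n] ⁻¹' s = s := by
      rw [Set.preimage_iterate_eq]
      exact Function.iterate_fixed hinv n
    exact Set.ext_iff.1 hn p
  have hstate : ∀ᵐ ω ∂(iidLaw ν), ∀ v w, (v, ω) ∈ s ↔ (w, ω) ∈ s := by
    filter_upwards [hco] with ω hω v w
    obtain ⟨n, hn⟩ := hω v w
    rw [← hiter n (v, ω), ← hiter n (w, ω), skewShift_iterate, skewShift_iterate, hn]
  obtain ⟨u⟩ := nonempty_of_isProbabilityMeasure π
  have hfibre : MeasurableSet {ω : ℕ → E | (u, ω) ∈ s} := measurable_prodMk_left hs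
  have hfibre_inv : seqShift ⁻¹' {ω : ℕ → E | (u, ω) ∈ s} =ᵐ[iidLaw ν] {ω | (u, ω) ∈ s} := by
    filter_upwards [(measurePreserving_seqShift ν).quasiMeasurePreserving.ae hstate] with ω hω
    exact propext ((hω u (φ u (ω 0))).trans (hiter 1 (u, ω)))
  have hsnd : ∀ᵐ p ∂(π.prod (iidLaw ν)), p ∈ s ↔ (u, p.2) ∈ s :=
    (Measure.quasiMeasurePreserving_snd.ae hstate).mono fun p hp => hp p.1 u
  rw [eventuallyConst_set]
  refine ((ergodic_seqShift ν).quasiErgodic.ae_mem_or_ae_notMem₀ hfibre.nullMeasurableSet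
    hfibre_inv).imp (fun h => ?_) fun h => ?_
  · filter_upwards [hsnd, Measure.quasiMeasurePreserving_snd.ae h] with p h1 h2 using h1.2 h2
  · filter_upwards [hsnd, Measure.quasiMeasurePreserving_snd.ae h] with p h1 h2
      using fun h3 => h2 (h1.1 h3)

lemma ae_forall_hasCesaroMean_drivenOrbit
    (hπ : MeasurePreserving (fun p : S × E => φ p.1 p.2) (π.prod ν) π)
    (hco : ∀ᵐ ω ∂(iidLaw ν), Coalesces φ ω) {f : S × E → ℝ} (hf : Integrable f (π.prod ν)) :
    ∀ᵐ ω ∂(iidLaw ν), ∀ s,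
      HasCesaroMean (fun k => f (drivenOrbit φ s ω k, ω k)) (∫ p, f p ∂(π.prod ν)) := by
  have heval : MeasurePreserving (fun p : S × (ℕ → E) => (p.1, p.2 0)) (π.prod (iidLaw ν))
      (π.prod ν) := (MeasurePreserving.id π).prod (measurePreserving_eval_iidLaw ν 0)
  have hbirkhoff := ae_tendsto_birkhoffAverage (ergodic_skewShift hπ hco)
    (heval.integrable_comp_of_integrable hf)
  rw [show ∫ q, (f ∘ fun p : S × (ℕ → E) => (p.1, p.2 0)) q ∂(π.prod (iidLaw ν)) =
    ∫ p, f p ∂(π.prod ν) from heval.hasLaw.integral_comp hf.aestronglyMeasurable] at hbirkhoff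
  obtain ⟨u, hu⟩ := (Measure.ae_ae_of_ae_prod hbirkhoff).exists
  filter_upwards [hu, hco] with ω hω hcoω s
  have hmean : HasCesaroMean (fun k => f (drivenOrbit φ u ω k, ω k)) (∫ p, f p ∂(π.prod ν)) := by
    simpa [HasCesaroMean, birkhoffAverage, birkhoffSum, skewShift_iterate, seqShift_iterate_apply,
      div_eq_inv_mul] using hω
  exact hmean.congr' ((hcoω.eventually_eq u s).mono fun k hk => by simp only [hk])

section Stationary

/-- The `n`-th state of the recursion started from `s` when the inputs are read backwards, the
first input `ω 0` being used last. It has the law of `drivenOrbit φ s ω n` if the inputs are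
i.i.d., but it can converge pathwise. -/
def backwardOrbit (φ : S → E → S) (s : S) : ℕ → (ℕ → E) → S
  | 0, _ => s
  | n + 1, ω => φ (backwardOrbit φ s n (seqShift ω)) (ω 0)

lemma measurable_backwardOrbit (hφ : Measurable fun p : S × E => φ p.1 p.2) (s : S) (n : ℕ) :
    Measurable (backwardOrbit φ s n) := by
  induction n with
  | zero => exact measurable_const
  | succ n ih => exact hφ.comp ((ih.comp measurable_seqShift).prodMk (measurable_pi_apply 0))

lemma measurePreserving_comp_seqShift_eval_zero {Z : (ℕ → E) → S} (hZ : Measurable Z) :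
    MeasurePreserving (fun ω => (Z (seqShift ω), ω 0)) (iidLaw ν) (((iidLaw ν).map Z).prod ν) :=
  have := Measure.isProbabilityMeasure_map (μ := iidLaw ν) hZ.aemeasurable
  ((hZ.measurePreserving (iidLaw ν)).prod (MeasurePreserving.id ν)).comp
    (measurePreserving_seqShift_eval_zero ν)

/-- Loynes' construction of a stationary law. -/
lemma measurePreserving_map_of_tendsto_backwardOrbit [TopologicalSpace S] [T2Space S]
    (hφ : Measurable fun p : S × E => φ p.1 p.2) (hcont : ∀ e, Continuous fun s => φ s e) {s : S}
    {Z : (ℕ → E) → S} (hZ : Measurable Z)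
    (hlim : ∀ᵐ ω ∂(iidLaw ν), Tendsto (fun n => backwardOrbit φ s n ω) atTop (𝓝 (Z ω))) :
    MeasurePreserving (fun p : S × E => φ p.1 p.2) (((iidLaw ν).map Z).prod ν)
      ((iidLaw ν).map Z) where
  measurable := hφ
  map_eq := by
    have hpair := measurePreserving_comp_seqShift_eval_zero (ν := ν) hZ
    rw [← hpair.map_eq, Measure.map_map hφ hpair.measurable]
    refine Measure.map_congr ?_
    filter_upwards [hlim, (measurePreserving_seqShift ν).quasiMeasurePreserving.ae hlim]
      with ω hω hshift
    exact tendsto_nhds_unique (((hcont (ω 0)).tendsto _).comp hshift)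
      (hω.comp (tendsto_add_atTop_nat 1))

end Stationary

end DrivenRecursions

section IndependentSequences

variable {Ω ι E : Type*} [MeasurableSpace Ω] [MeasurableSpace E] {μ : Measure Ω}

lemma hasLaw_iidLaw {Y : ℕ → Ω → E} (hindep : iIndepFun Y μ)
    (hident : ∀ k, IdentDistrib (Y k) (Y 0) μ μ) :
    HasLaw (fun ω k => Y k ω) (iidLaw (μ.map (Y 0))) μ :=
  hindep.hasLaw_infinitePi (fun k => ⟨(hident k).aemeasurable_fst, (hident k).map_eq⟩)
    (aemeasurable_pi_iff.2 fun k => (hident k).aemeasurable_fst)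

variable {U V : ι → Ω → E}

lemma measure_biInter_prodMk_preimage_prod (h : iIndepFun (Sum.elim U V) μ)
    (S : Finset ι) {s t : ι → Set E} (hs : ∀ k ∈ S, MeasurableSet (s k))
    (ht : ∀ k ∈ S, MeasurableSet (t k)) :
    μ (⋂ k ∈ S, (fun ω => (U k ω, V k ω)) ⁻¹' (s k ×ˢ t k)) =
      (∏ k ∈ S, μ (U k ⁻¹' s k)) * ∏ k ∈ S, μ (V k ⁻¹' t k) := by
  convert h.measure_inter_preimage_eq_mul (S.disjSum S) (sets := Sum.elim s t) ?_ using 1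
  · congr 1
    ext ω
    simp [forall_and]
  · simp
  · simpa using ⟨hs, ht⟩

lemma iIndepFun_prodMk_of_iIndepFun_sumElim (hU : ∀ k, Measurable (U k))
    (hV : ∀ k, Measurable (V k)) (h : iIndepFun (Sum.elim U V) μ) :
    iIndepFun (fun k ω => (U k ω, V k ω)) μ := by
  refine iIndepSets.iIndep (π := fun k => (fun s => (fun ω => (U k ω, V k ω)) ⁻¹' s) ''
      Set.image2 (· ×ˢ ·) {s | MeasurableSet s} {t | MeasurableSet t})
    (fun k => ((hU k).prodMk (hV k)).comap_le) (fun k => isPiSystem_prod.comap _)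
    (fun k => by rw [← MeasurableSpace.comap_generateFrom, generateFrom_prod]) ?_
  rw [iIndepSets_iff]
  intro S f hf
  choose! r hr hrf using hf
  choose! s hs t ht hst using hr
  have hf (k) (hk : k ∈ S) : f k = (fun ω => (U k ω, V k ω)) ⁻¹' (s k ×ˢ t k) := by
    rw [← hrf k hk, ← hst k hk]
  rw [Set.iInter₂_congr hf, Finset.prod_congr rfl fun k hk => congrArg μ (hf k hk),
    measure_biInter_prodMk_preimage_prod h S hs ht, ← Finset.prod_mul_distrib]
  refine Finset.prod_congr rfl fun k hk => ?_
  have hpair := measure_biInter_prodMk_preimage_prod h {k} (s := s) (t := t)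
    (by simpa using hs k hk) (by simpa using ht k hk)
  simpa using hpair.symm

end IndependentSequences

namespace GG1

section Lindley

/-- One step of Lindley's recursion for the sojourn times: if a packet spends time `u` in the
system, and the next one arrives `e.1` later and requires service `e.2`, then the latter spends
time `sojournStep u e` in the system. -/
noncomputable def sojournStep (u : ℝ) (e : ℝ × ℝ) : ℝ := max (u - e.1) 0 + e.2

lemma measurable_sojournStep : Measurable fun p : ℝ × (ℝ × ℝ) => sojournStep p.1 p.2 := by
  unfold sojournStep; fun_prop

lemma continuous_sojournStep (e : ℝ × ℝ) : Continuous fun u => sojournStep u e := by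
  unfold sojournStep; fun_prop

lemma monotone_sojournStep (e : ℝ × ℝ) : Monotone fun u => sojournStep u e := fun u v h => by
  simp only [sojournStep]; gcongr

lemma sub_add_le_sojournStep (u : ℝ) (e : ℝ × ℝ) : u - e.1 + e.2 ≤ sojournStep u e := by
  unfold sojournStep; gcongr; exact le_max_left _ _

lemma sojournStep_nonneg {e : ℝ × ℝ} (he : 0 ≤ e.2) (u : ℝ) : 0 ≤ sojournStep u e :=
  add_nonneg (le_max_right _ _) he

lemma sojournStep_le_add {u : ℝ} {e : ℝ × ℝ} (hu : 0 ≤ u) (he : 0 ≤ e.1) :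
    sojournStep u e ≤ u + e.2 := by
  unfold sojournStep; gcongr; exact max_le (by linarith) hu

lemma sojournStep_sq_le {u : ℝ} {e : ℝ × ℝ} (hu : 0 ≤ u) (h1 : 0 ≤ e.1) (h2 : 0 ≤ e.2) :
    sojournStep u e ^ 2 ≤ u ^ 2 - 2 * (u * (e.1 - e.2)) + (e.1 ^ 2 + e.2 ^ 2) := by
  unfold sojournStep
  rcases le_total (u - e.1) 0 with h | h
  · rw [max_eq_right h]; nlinarith [sq_nonneg (u - e.1), mul_nonneg hu h2]
  · rw [max_eq_left h]; nlinarith [mul_nonneg h1 h2]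

/-- Two copies of the queue with the same input agree once the larger one has emptied. -/
lemma coalesces_sojournStep {ω : ℕ → ℝ × ℝ} (hfst : ∀ k, 0 ≤ (ω k).1)
    (hdrift : Tendsto (fun n => ∑ k ∈ Finset.range n, ((ω k).1 - (ω k).2)) atTop atTop) :
    Coalesces sojournStep ω := by
  have hempty (w : ℝ) : ∃ m, drivenOrbit sojournStep w ω m ≤ (ω m).1 := by
    by_contra! hbusy
    have hsum (n : ℕ) :
        drivenOrbit sojournStep w ω n = w - ∑ k ∈ Finset.range n, ((ω k).1 - (ω k).2) := by
      induction n with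
      | zero => simp [drivenOrbit]
      | succ n ih =>
        rw [drivenOrbit, sojournStep, max_eq_left (sub_nonneg.2 (hbusy n).le), ih,
          Finset.sum_range_succ]
        ring
    obtain ⟨n, hn⟩ := (hdrift.eventually_ge_atTop w).exists
    linarith [hsum n, hbusy n, hfst n]
  have hmono {v w : ℝ} (hvw : v ≤ w) (n : ℕ) :
      drivenOrbit sojournStep v ω n ≤ drivenOrbit sojournStep w ω n := by
    induction n with
    | zero => exact hvw
    | succ n ih => exact monotone_sojournStep _ ih
  intro v w
  wlog hvw : v ≤ w generalizing v w
  · exact (this w v (le_of_not_ge hvw)).imp fun n => Eq.symm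
  obtain ⟨m, hm⟩ := hempty w
  refine ⟨m + 1, ?_⟩
  rw [drivenOrbit, drivenOrbit, sojournStep, sojournStep, max_eq_right (sub_nonpos.2 hm),
    max_eq_right (sub_nonpos.2 ((hmono hvw m).trans hm))]

/-- Conditions on the joint law of an inter-arrival time and a service time under which the queue
is stable and its stationary age has a finite mean. -/
structure IsStableLaw (ν : Measure (ℝ × ℝ)) : Prop where
  fst_nonneg : ∀ᵐ e ∂ν, 0 ≤ e.1
  snd_nonneg : ∀ᵐ e ∂ν, 0 ≤ e.2
  memLp_fst : MemLp (fun e : ℝ × ℝ => e.1) 2 ν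
  memLp_snd : MemLp (fun e : ℝ × ℝ => e.2) 2 ν
  integral_lt : ∫ e, e.2 ∂ν < ∫ e, e.1 ∂ν

lemma IsStableLaw.integral_fst_pos {ν : Measure (ℝ × ℝ)} (hν : IsStableLaw ν) :
    0 < ∫ e, e.1 ∂ν :=
  (integral_nonneg_of_ae hν.snd_nonneg).trans_lt hν.integral_lt

lemma IsStableLaw.ae_prod_nonneg {ν : Measure (ℝ × ℝ)} (hν : IsStableLaw ν) {ρ : Measure ℝ}
    (hρ : ∀ᵐ u ∂ρ, 0 ≤ u) :
    ∀ᵐ p ∂(ρ.prod ν), 0 ≤ p.1 ∧ 0 ≤ p.2.1 ∧ 0 ≤ p.2.2 := by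
  filter_upwards [Measure.quasiMeasurePreserving_fst.ae hρ,
    Measure.quasiMeasurePreserving_snd.ae hν.fst_nonneg,
    Measure.quasiMeasurePreserving_snd.ae hν.snd_nonneg] with p h0 h1 h2 using ⟨h0, h1, h2⟩

variable {ν : Measure (ℝ × ℝ)} [IsProbabilityMeasure ν]

lemma IsStableLaw.integrable_fst (hν : IsStableLaw ν) : Integrable (fun e : ℝ × ℝ => e.1) ν :=
  hν.memLp_fst.integrable one_le_two

lemma IsStableLaw.integrable_snd (hν : IsStableLaw ν) : Integrable (fun e : ℝ × ℝ => e.2) ν :=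
  hν.memLp_snd.integrable one_le_two

lemma IsStableLaw.ae_nonneg (hν : IsStableLaw ν) :
    ∀ᵐ ω ∂(iidLaw ν), ∀ k, 0 ≤ (ω k).1 ∧ 0 ≤ (ω k).2 :=
  ae_all_iff.2 fun k => (measurePreserving_eval_iidLaw ν k).quasiMeasurePreserving.ae
    (hν.fst_nonneg.and hν.snd_nonneg)

lemma IsStableLaw.ae_coalesces (hν : IsStableLaw ν) :
    ∀ᵐ ω ∂(iidLaw ν), Coalesces sojournStep ω := by
  filter_upwards [hν.ae_nonneg,
    ae_hasCesaroMean_iidLaw ν (hν.integrable_fst.sub hν.integrable_snd)] with ω hω hmean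
  refine coalesces_sojournStep (fun k => (hω k).1) (tendsto_atTop_of_tendsto_div_natCast ?_ hmean)
  exact (sub_pos.2 hν.integral_lt).trans_eq
    (integral_sub hν.integrable_fst hν.integrable_snd).symm

section SecondMoment

variable {ρ : Measure ℝ} [IsProbabilityMeasure ρ]

lemma memLp_sojournStep (hν : IsStableLaw ν) (hρ : MemLp (fun u => u) 2 ρ) :
    MemLp (fun p : ℝ × (ℝ × ℝ) => sojournStep p.1 p.2) 2 (ρ.prod ν) :=
  (((hρ.comp_fst ν).sub (hν.memLp_fst.comp_snd ρ)).sup MemLp.zero).add (hν.memLp_snd.comp_snd ρ)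

lemma integral_sojournStep_sq_le (hν : IsStableLaw ν) (hρ : MemLp (fun u => u) 2 ρ)
    (hρ0 : ∀ᵐ u ∂ρ, 0 ≤ u) :
    ∫ p, sojournStep p.1 p.2 ^ 2 ∂(ρ.prod ν) ≤ ∫ u, u ^ 2 ∂ρ
      - 2 * ((∫ u, u ∂ρ) * (∫ e, e.1 ∂ν - ∫ e, e.2 ∂ν)) + ∫ e, (e.1 ^ 2 + e.2 ^ 2) ∂ν := by
  have hu : Integrable (fun p : ℝ × (ℝ × ℝ) => p.1 ^ 2) (ρ.prod ν) := hρ.integrable_sq.comp_fst ν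
  have hcross : Integrable (fun p : ℝ × (ℝ × ℝ) => p.1 * (p.2.1 - p.2.2)) (ρ.prod ν) :=
    (hρ.integrable one_le_two).mul_prod (hν.integrable_fst.sub hν.integrable_snd)
  have he : Integrable (fun p : ℝ × (ℝ × ℝ) => p.2.1 ^ 2 + p.2.2 ^ 2) (ρ.prod ν) :=
    (hν.memLp_fst.integrable_sq.add hν.memLp_snd.integrable_sq).comp_snd ρ
  have hdiff : Integrable (fun p : ℝ × (ℝ × ℝ) => p.1 ^ 2 - 2 * (p.1 * (p.2.1 - p.2.2)))
      (ρ.prod ν) := hu.sub (hcross.const_mul 2)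
  calc ∫ p, sojournStep p.1 p.2 ^ 2 ∂(ρ.prod ν)
      ≤ ∫ p, (p.1 ^ 2 - 2 * (p.1 * (p.2.1 - p.2.2)) + (p.2.1 ^ 2 + p.2.2 ^ 2)) ∂(ρ.prod ν) := by
        refine integral_mono_ae (memLp_sojournStep hν hρ).integrable_sq
          (hdiff.add he) ?_
        filter_upwards [hν.ae_prod_nonneg hρ0] with p ⟨h0, h1, h2⟩
        exact sojournStep_sq_le h0 h1 h2
    _ = _ := by
        rw [integral_add hdiff he, integral_sub hu (hcross.const_mul 2),
          integral_const_mul, integral_prod_mul (fun u : ℝ => u) (fun e : ℝ × ℝ => e.1 - e.2),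
          integral_sub hν.integrable_fst hν.integrable_snd,
          integral_fun_fst (fun u : ℝ => u ^ 2),
          integral_fun_snd (fun e : ℝ × ℝ => e.1 ^ 2 + e.2 ^ 2)]
        simp

end SecondMoment

lemma monotone_backwardOrbit_sojournStep {ω : ℕ → ℝ × ℝ} (hω : ∀ k, 0 ≤ (ω k).2) :
    Monotone fun n => backwardOrbit sojournStep 0 n ω := by
  refine monotone_nat_of_le_succ fun n => ?_
  induction n generalizing ω with
  | zero => exact sojournStep_nonneg (hω 0) _
  | succ n ih => exact monotone_sojournStep _ (ih fun k => hω (k + 1))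

lemma memLp_backwardOrbit_sojournStep (hν : IsStableLaw ν) (n : ℕ) :
    MemLp (backwardOrbit sojournStep 0 n) 2 (iidLaw ν) := by
  induction n with
  | zero => exact MemLp.zero
  | succ n ih =>
    have hmeas := measurable_backwardOrbit measurable_sojournStep 0 n
    have := Measure.isProbabilityMeasure_map (μ := iidLaw ν) hmeas.aemeasurable
    exact (memLp_sojournStep hν ((memLp_map_measure_iff aestronglyMeasurable_id
      hmeas.aemeasurable).2 ih)).comp_measurePreserving
      (measurePreserving_comp_seqShift_eval_zero hmeas)

/-- The second moments of successive backward sojourn times increase, while by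
`integral_sojournStep_sq_le` the negative drift makes them decrease in proportion to the mean. -/
lemma integral_backwardOrbit_sojournStep_le (hν : IsStableLaw ν) (n : ℕ) :
    ∫ ω, backwardOrbit sojournStep 0 n ω ∂(iidLaw ν) ≤
      (∫ e, (e.1 ^ 2 + e.2 ^ 2) ∂ν) / (2 * (∫ e, e.1 ∂ν - ∫ e, e.2 ∂ν)) := by
  have hmeas := measurable_backwardOrbit measurable_sojournStep 0 n
  have hlaw := hmeas.measurePreserving (iidLaw ν)
  have := Measure.isProbabilityMeasure_map (μ := iidLaw ν) hmeas.aemeasurable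
  have hmemLp := memLp_backwardOrbit_sojournStep hν
  have hincr : ∫ ω, backwardOrbit sojournStep 0 n ω ^ 2 ∂(iidLaw ν) ≤
      ∫ ω, backwardOrbit sojournStep 0 (n + 1) ω ^ 2 ∂(iidLaw ν) := by
    refine integral_mono_ae (hmemLp n).integrable_sq (hmemLp (n + 1)).integrable_sq ?_
    filter_upwards [hν.ae_nonneg] with ω hω
    have hmono := monotone_backwardOrbit_sojournStep fun k => (hω k).2
    exact pow_le_pow_left₀ (hmono n.zero_le) (hmono n.le_succ) 2
  have hnonneg : ∀ᵐ u ∂(iidLaw ν).map (backwardOrbit sojournStep 0 n), 0 ≤ u := by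
    refine (ae_map_iff hmeas.aemeasurable measurableSet_Ici).2 ?_
    filter_upwards [hν.ae_nonneg] with ω hω
    exact monotone_backwardOrbit_sojournStep (fun k => (hω k).2) n.zero_le
  have hdecr := integral_sojournStep_sq_le hν
    ((memLp_map_measure_iff aestronglyMeasurable_id hmeas.aemeasurable).2 (hmemLp n)) hnonneg
  rw [← (measurePreserving_comp_seqShift_eval_zero hmeas).hasLaw.integral_comp
      (measurable_sojournStep.pow_const 2).aestronglyMeasurable,
    ← hlaw.hasLaw.integral_comp (f := fun u => u ^ 2) (by fun_prop),
    ← hlaw.hasLaw.integral_comp (f := fun u => u) (by fun_prop)] at hdecr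
  rw [le_div_iff₀ (mul_pos two_pos (sub_pos.2 hν.integral_lt))]
  simp only [Function.comp_def] at hdecr
  simp only [backwardOrbit] at hincr
  linarith

/-- Loynes' stationary sojourn time. -/
noncomputable def loynesSojourn (ω : ℕ → ℝ × ℝ) : ℝ := ⨆ n, backwardOrbit sojournStep 0 n ω

lemma measurable_loynesSojourn : Measurable loynesSojourn :=
  .iSup fun n => measurable_backwardOrbit measurable_sojournStep 0 n

lemma IsStableLaw.ae_tendsto_backwardOrbit (hν : IsStableLaw ν) : ∀ᵐ ω ∂(iidLaw ν),
    Tendsto (fun n => backwardOrbit sojournStep 0 n ω) atTop (𝓝 (loynesSojourn ω)) :=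
  ae_tendsto_iSup_of_integral_le
    (fun n => (memLp_backwardOrbit_sojournStep hν n).integrable one_le_two)
    (ae_of_all _ fun _ => le_rfl)
    (hν.ae_nonneg.mono fun _ hω => monotone_backwardOrbit_sojournStep fun k => (hω k).2)
    (integral_backwardOrbit_sojournStep_le hν)

lemma IsStableLaw.integrable_loynesSojourn (hν : IsStableLaw ν) :
    Integrable loynesSojourn (iidLaw ν) :=
  integrable_iSup_of_integral_le
    (fun n => (memLp_backwardOrbit_sojournStep hν n).integrable one_le_two)
    (ae_of_all _ fun _ => le_rfl)
    (hν.ae_nonneg.mono fun _ hω => monotone_backwardOrbit_sojournStep fun k => (hω k).2)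
    (integral_backwardOrbit_sojournStep_le hν)

/-- The law of the sojourn time in the stationary queue. -/
noncomputable def stationaryLaw (ν : Measure (ℝ × ℝ)) [IsProbabilityMeasure ν] : Measure ℝ :=
  (iidLaw ν).map loynesSojourn

instance : IsProbabilityMeasure (stationaryLaw ν) :=
  Measure.isProbabilityMeasure_map measurable_loynesSojourn.aemeasurable

lemma IsStableLaw.integrable_stationaryLaw (hν : IsStableLaw ν) :
    Integrable (fun u : ℝ => u) (stationaryLaw ν) :=
  (integrable_map_measure aestronglyMeasurable_id measurable_loynesSojourn.aemeasurable).2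
    hν.integrable_loynesSojourn

lemma IsStableLaw.ae_stationaryLaw_nonneg (hν : IsStableLaw ν) :
    ∀ᵐ u ∂(stationaryLaw ν), 0 ≤ u := by
  refine (ae_map_iff measurable_loynesSojourn.aemeasurable measurableSet_Ici).2 ?_
  filter_upwards [hν.ae_nonneg] with ω hω
  exact Real.iSup_nonneg fun n => monotone_backwardOrbit_sojournStep (fun k => (hω k).2) n.zero_le

lemma IsStableLaw.measurePreserving_sojournStep (hν : IsStableLaw ν) :
    MeasurePreserving (fun p : ℝ × (ℝ × ℝ) => sojournStep p.1 p.2) ((stationaryLaw ν).prod ν)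
      (stationaryLaw ν) :=
  measurePreserving_map_of_tendsto_backwardOrbit measurable_sojournStep continuous_sojournStep
    measurable_loynesSojourn hν.ae_tendsto_backwardOrbit

end Lindley

section AgeArea

/-- The area below the age between two successive receptions, when the packet received first spent
time `u` in the system, the next one arrived `e.1` later, and required service `e.2`: the age grows
linearly from `u` to `sojournStep u e + e.1`. -/
noncomputable def ageArea (u : ℝ) (e : ℝ × ℝ) : ℝ := ((sojournStep u e + e.1) ^ 2 - u ^ 2) / 2

lemma measurable_ageArea : Measurable fun p : ℝ × (ℝ × ℝ) => ageArea p.1 p.2 := by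
  have := measurable_sojournStep
  unfold ageArea; fun_prop

lemma ageArea_nonneg {u : ℝ} {e : ℝ × ℝ} (hu : 0 ≤ u) (he : 0 ≤ e.2) : 0 ≤ ageArea u e := by
  have hle : u ≤ sojournStep u e + e.1 := by linarith [sub_add_le_sojournStep u e]
  exact div_nonneg (sub_nonneg.2 (pow_le_pow_left₀ hu hle 2)) two_pos.le

lemma ageArea_le {u : ℝ} {e : ℝ × ℝ} (hu : 0 ≤ u) (h1 : 0 ≤ e.1) (h2 : 0 ≤ e.2) :
    ageArea u e ≤ u * (e.1 + e.2) + (e.1 + e.2) ^ 2 / 2 := by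
  have hsq : (sojournStep u e + e.1) ^ 2 ≤ (u + e.2 + e.1) ^ 2 :=
    pow_le_pow_left₀ (add_nonneg (sojournStep_nonneg h2 u) h1)
      (add_le_add_left (sojournStep_le_add hu h1) _) 2
  unfold ageArea
  linarith

lemma ageArea_eq (u : ℝ) (e : ℝ × ℝ) : ageArea u e =
    sojournStep u e * e.1 + e.1 ^ 2 / 2 + (sojournStep u e ^ 2 / 2 - u ^ 2 / 2) := by
  unfold ageArea; ring

lemma abs_sojournStep_mul_fst_add_sub_le {u : ℝ} {e : ℝ × ℝ} (hu : 0 ≤ u) (he : 0 ≤ e.1) :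
    |sojournStep u e * e.1 + e.1 ^ 2 / 2 - (u * e.1 + e.1 * e.2)| ≤ e.1 ^ 2 / 2 := by
  have hle := mul_le_mul_of_nonneg_right (sojournStep_le_add hu he) he
  have hge := mul_le_mul_of_nonneg_right (sub_add_le_sojournStep u e) he
  rw [abs_le]
  constructor <;> linarith

variable {ν : Measure (ℝ × ℝ)} [IsProbabilityMeasure ν]

lemma IsStableLaw.integrable_ageArea (hν : IsStableLaw ν) :
    Integrable (fun p : ℝ × (ℝ × ℝ) => ageArea p.1 p.2) ((stationaryLaw ν).prod ν) := by
  refine ((hν.integrable_stationaryLaw.mul_prod (hν.integrable_fst.add hν.integrable_snd)).add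
    (((hν.memLp_fst.add hν.memLp_snd).integrable_sq.comp_snd (stationaryLaw ν)).div_const 2)).mono'
    measurable_ageArea.aestronglyMeasurable ?_
  filter_upwards [hν.ae_prod_nonneg hν.ae_stationaryLaw_nonneg] with p ⟨h0, h1, h2⟩
  rw [Real.norm_of_nonneg (ageArea_nonneg h0 h2)]
  exact ageArea_le h0 h1 h2

lemma IsStableLaw.integrable_mul_fst_add_fst_mul_snd (hν : IsStableLaw ν) :
    Integrable (fun p : ℝ × (ℝ × ℝ) => p.1 * p.2.1 + p.2.1 * p.2.2) ((stationaryLaw ν).prod ν) :=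
  (hν.integrable_stationaryLaw.mul_prod hν.integrable_fst).add
    ((hν.memLp_fst.integrable_mul hν.memLp_snd).comp_snd (stationaryLaw ν))

lemma IsStableLaw.integrable_sojournStep_mul_fst_add (hν : IsStableLaw ν) :
    Integrable (fun p : ℝ × (ℝ × ℝ) => sojournStep p.1 p.2 * p.2.1 + p.2.1 ^ 2 / 2)
      ((stationaryLaw ν).prod ν) := by
  refine (hν.integrable_mul_fst_add_fst_mul_snd.add
    ((hν.memLp_fst.integrable_sq.comp_snd (stationaryLaw ν)).div_const 2)).mono' ?_ ?_
  · have := measurable_sojournStep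
    fun_prop
  · filter_upwards [hν.ae_prod_nonneg hν.ae_stationaryLaw_nonneg] with p ⟨h0, h1, h2⟩
    rw [Real.norm_of_nonneg (by have := sojournStep_nonneg h2 p.1; positivity)]
    have hle := mul_le_mul_of_nonneg_right (sojournStep_le_add h0 h1) h1
    simp only [Pi.add_apply]
    linarith

/-- The squares of successive sojourn times need not be integrable, but in stationarity their
difference has zero mean. -/
lemma IsStableLaw.integral_ageArea (hν : IsStableLaw ν) :
    ∫ p, ageArea p.1 p.2 ∂((stationaryLaw ν).prod ν) =
      ∫ p, (sojournStep p.1 p.2 * p.2.1 + p.2.1 ^ 2 / 2) ∂((stationaryLaw ν).prod ν) := by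
  have hident : IdentDistrib (fun p : ℝ × (ℝ × ℝ) => sojournStep p.1 p.2) Prod.fst
      ((stationaryLaw ν).prod ν) ((stationaryLaw ν).prod ν) :=
    ⟨measurable_sojournStep.aemeasurable, measurable_fst.aemeasurable, by
      rw [hν.measurePreserving_sojournStep.map_eq, measurePreserving_fst.map_eq]⟩
  have hdiff : Integrable (fun p : ℝ × (ℝ × ℝ) => sojournStep p.1 p.2 ^ 2 / 2 - p.1 ^ 2 / 2)
      ((stationaryLaw ν).prod ν) :=
    (hν.integrable_ageArea.sub hν.integrable_sojournStep_mul_fst_add).congr <|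
      ae_of_all _ fun p => by simp only [Pi.sub_apply, ageArea_eq, add_sub_cancel_left]
  have hzero : ∫ p, (sojournStep p.1 p.2 ^ 2 / 2 - p.1 ^ 2 / 2) ∂((stationaryLaw ν).prod ν) = 0 :=
    integral_sub_eq_zero_of_identDistrib (hident.comp (u := fun u => u ^ 2 / 2) (by fun_prop)) hdiff
  simp only [ageArea_eq]
  rw [integral_add hν.integrable_sojournStep_mul_fst_add hdiff, hzero, add_zero]

lemma IsStableLaw.abs_integral_ageArea_sub_le (hν : IsStableLaw ν) :
    |∫ p, ageArea p.1 p.2 ∂((stationaryLaw ν).prod ν)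
      - ((∫ u, u ∂(stationaryLaw ν)) * (∫ e, e.1 ∂ν) + ∫ e, e.1 * e.2 ∂ν)| ≤
      (∫ e, e.1 ^ 2 ∂ν) / 2 := by
  have hmain := integral_add (hν.integrable_stationaryLaw.mul_prod hν.integrable_fst)
    ((hν.memLp_fst.integrable_mul hν.memLp_snd).comp_snd (stationaryLaw ν))
  simp only [Pi.mul_apply] at hmain
  rw [integral_prod_mul (fun u : ℝ => u) (fun e : ℝ × ℝ => e.1),
    integral_fun_snd (fun e : ℝ × ℝ => e.1 * e.2), probReal_univ, one_smul] at hmain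
  rw [hν.integral_ageArea, ← hmain, ← integral_sub hν.integrable_sojournStep_mul_fst_add
    hν.integrable_mul_fst_add_fst_mul_snd, ← Real.norm_eq_abs]
  calc _ ≤ ∫ p, p.2.1 ^ 2 / 2 ∂((stationaryLaw ν).prod ν) :=
        norm_integral_le_of_norm_le
          ((hν.memLp_fst.integrable_sq.comp_snd (stationaryLaw ν)).div_const 2) <|
          (hν.ae_prod_nonneg hν.ae_stationaryLaw_nonneg).mono fun p hp =>
            abs_sojournStep_mul_fst_add_sub_le hp.1 hp.2.1
    _ = _ := by
        rw [integral_div, integral_fun_snd (fun e : ℝ × ℝ => e.1 ^ 2), probReal_univ, one_smul]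

end AgeArea

section SamplePath

variable {w₀ a₀ : ℝ} {i x : ℕ → ℝ}

/-- The sojourn times on a sample path: `sojourn w₀ i x (k + 1)` is the time packet `k` spends in
the system, and the initial backlog plays the role of the sojourn time of a packet that arrived at
time `0`. -/
noncomputable def sojourn (w₀ : ℝ) (i x : ℕ → ℝ) : ℕ → ℝ :=
  drivenOrbit sojournStep w₀ fun k => (i k, x k)

lemma sojourn_succ (w₀ : ℝ) (i x : ℕ → ℝ) (k : ℕ) :
    sojourn w₀ i x (k + 1) = sojournStep (sojourn w₀ i x k) (i k, x k) := rfl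

lemma arrival_succ (i : ℕ → ℝ) (k : ℕ) : arrival i (k + 1) = arrival i k + i (k + 1) :=
  Finset.sum_range_succ i (k + 1)

lemma departure_eq (w₀ : ℝ) (i x : ℕ → ℝ) (k : ℕ) :
    departure w₀ i x k = arrival i k + sojourn w₀ i x (k + 1) := by
  induction k with
  | zero =>
    rw [departure, sojourn_succ, sojournStep, ← add_assoc, ← max_add_add_left]
    simp [arrival, sojourn, drivenOrbit]
  | succ k ih =>
    rw [departure, sojourn_succ, sojournStep, ih, ← add_assoc, ← max_add_add_left, arrival_succ]
    ring_nf

lemma arrival_nonneg (hi : ∀ k, 0 ≤ i k) (k : ℕ) : 0 ≤ arrival i k :=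
  Finset.sum_nonneg fun j _ => hi j

lemma monotone_arrival (hi : ∀ k, 0 ≤ i k) : Monotone (arrival i) :=
  monotone_nat_of_le_succ fun k => arrival_succ i k ▸ le_add_of_nonneg_right (hi (k + 1))

lemma departure_add_le_succ (w₀ : ℝ) (i x : ℕ → ℝ) (k : ℕ) :
    departure w₀ i x k + x (k + 1) ≤ departure w₀ i x (k + 1) := by
  rw [departure]; gcongr; exact le_max_left _ _

lemma monotone_departure (hx : ∀ k, 0 ≤ x k) : Monotone (departure w₀ i x) :=
  monotone_nat_of_le_succ fun k =>
    (le_add_of_nonneg_right (hx (k + 1))).trans (departure_add_le_succ w₀ i x k)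

lemma arrival_le_departure (hx : ∀ k, 0 ≤ x k) (k : ℕ) : arrival i k ≤ departure w₀ i x k :=
  departure_eq w₀ i x k ▸ le_add_of_nonneg_right (sojournStep_nonneg (hx k) _)

lemma age_of_lt (hx : ∀ k, 0 ≤ x k) {t : ℝ} (ht : t < departure w₀ i x 0) :
    age w₀ a₀ i x t = t + a₀ := by
  have hempty : {s : ℝ | ∃ k : ℕ, departure w₀ i x k ≤ t ∧ s = arrival i k} = ∅ :=
    Set.eq_empty_of_forall_notMem fun _ ⟨k, hk, _⟩ =>
      (ht.trans_le (monotone_departure hx k.zero_le)).not_ge hk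
  rw [age, lastGenerated, hempty]
  simp

lemma age_of_mem_Ico (ha₀ : 0 ≤ a₀) (hi : ∀ k, 0 ≤ i k) (hx : ∀ k, 0 ≤ x k) {k : ℕ} {t : ℝ}
    (ht : t ∈ Set.Ico (departure w₀ i x k) (departure w₀ i x (k + 1))) :
    age w₀ a₀ i x t = t - arrival i k := by
  have hgreatest : IsGreatest
      (insert (-a₀) {s : ℝ | ∃ k : ℕ, departure w₀ i x k ≤ t ∧ s = arrival i k})
      (arrival i k) := by
    refine ⟨Or.inr ⟨k, ht.1, rfl⟩, ?_⟩
    rintro s (rfl | ⟨j, hj, rfl⟩)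
    · exact (neg_nonpos.2 ha₀).trans (arrival_nonneg hi k)
    · exact monotone_arrival hi (Nat.lt_succ_iff.1
        ((monotone_departure hx).reflect_lt (hj.trans_lt ht.2)))
  rw [age, lastGenerated, hgreatest.csSup_eq]

lemma age_nonneg (ha₀ : 0 ≤ a₀) (hx : ∀ k, 0 ≤ x k) {t : ℝ} (ht : 0 ≤ t) :
    0 ≤ age w₀ a₀ i x t := by
  refine sub_nonneg.2 (csSup_le (Set.insert_nonempty _ _) ?_)
  rintro s (rfl | ⟨k, hk, rfl⟩)
  · linarith
  · exact (arrival_le_departure hx k).trans hk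

lemma peak_succ (ha₀ : 0 ≤ a₀) (hi : ∀ k, 0 ≤ i k) (hx : ∀ k, 0 < x k) (k : ℕ) :
    peak w₀ a₀ i x (k + 1) = sojourn w₀ i x (k + 2) + i (k + 1) := by
  have hlt : departure w₀ i x k < departure w₀ i x (k + 1) :=
    (lt_add_of_pos_right _ (hx (k + 1))).trans_le (departure_add_le_succ w₀ i x k)
  have hlim : Tendsto (age w₀ a₀ i x) (𝓝[<] departure w₀ i x (k + 1))
      (𝓝 (departure w₀ i x (k + 1) - arrival i k)) := by
    refine (((continuous_sub_right (arrival i k)).tendsto _).mono_left nhdsWithin_le_nhds).congr' ?_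
    filter_upwards [Ioo_mem_nhdsLT hlt] with t ht
    exact (age_of_mem_Ico ha₀ hi (fun k => (hx k).le) ⟨ht.1.le, ht.2⟩).symm
  rw [peak, leftLim_eq_of_tendsto hlim, departure_eq, arrival_succ]
  ring

lemma intervalIntegrable_age_departure_succ (ha₀ : 0 ≤ a₀) (hi : ∀ k, 0 ≤ i k)
    (hx : ∀ k, 0 ≤ x k) (k : ℕ) : IntervalIntegrable (age w₀ a₀ i x) volume
      (departure w₀ i x k) (departure w₀ i x (k + 1)) := by
  refine ((continuous_sub_right (arrival i k)).intervalIntegrable _ _).congr_uIoo fun t ht => ?_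
  rw [Set.uIoo_of_le (monotone_departure hx k.le_succ)] at ht
  exact (age_of_mem_Ico ha₀ hi hx ⟨ht.1.le, ht.2⟩).symm

lemma intervalIntegrable_age_departure (ha₀ : 0 ≤ a₀) (hi : ∀ k, 0 ≤ i k) (hx : ∀ k, 0 ≤ x k)
    (k : ℕ) : IntervalIntegrable (age w₀ a₀ i x) volume 0 (departure w₀ i x k) := by
  induction k with
  | zero =>
    refine ((continuous_add_const a₀).intervalIntegrable _ _).congr_uIoo fun t ht => ?_
    rw [Set.uIoo_of_le ((arrival_nonneg hi 0).trans (arrival_le_departure hx 0))] at ht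
    exact (age_of_lt hx ht.2).symm
  | succ k ih => exact ih.trans (intervalIntegrable_age_departure_succ ha₀ hi hx k)

lemma integral_age_departure_succ (ha₀ : 0 ≤ a₀) (hi : ∀ k, 0 ≤ i k) (hx : ∀ k, 0 ≤ x k)
    (k : ℕ) : ∫ t in (departure w₀ i x k)..(departure w₀ i x (k + 1)), age w₀ a₀ i x t =
      ageArea (sojourn w₀ i x (k + 1)) (i (k + 1), x (k + 1)) := by
  rw [intervalIntegral.integral_congr_Ioo_of_le (g := fun t => t - arrival i k)
    (monotone_departure hx k.le_succ) fun t ht => age_of_mem_Ico ha₀ hi hx ⟨ht.1.le, ht.2⟩,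
    intervalIntegral.integral_comp_sub_right (fun t => t), integral_id, ageArea, ← sojourn_succ,
    departure_eq, departure_eq, arrival_succ]
  ring

lemma integral_age_departure (ha₀ : 0 ≤ a₀) (hi : ∀ k, 0 ≤ i k) (hx : ∀ k, 0 ≤ x k) (n : ℕ) :
    ∫ t in (0 : ℝ)..(departure w₀ i x n), age w₀ a₀ i x t =
      (∫ t in (0 : ℝ)..(departure w₀ i x 0), age w₀ a₀ i x t) +
        ∑ k ∈ Finset.range n, ageArea (sojourn w₀ i x (k + 1)) (i (k + 1), x (k + 1)) := by
  simp only [← integral_age_departure_succ (a₀ := a₀) ha₀ hi hx]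
  rw [intervalIntegral.sum_integral_adjacent_intervals fun k _ =>
      intervalIntegrable_age_departure_succ ha₀ hi hx k,
    intervalIntegral.integral_add_adjacent_intervals
      (intervalIntegrable_age_departure ha₀ hi hx 0)
      ((intervalIntegrable_age_departure ha₀ hi hx 0).symm.trans
        (intervalIntegrable_age_departure ha₀ hi hx n))]

lemma hasPeakAge_of_hasCesaroMean (ha₀ : 0 ≤ a₀) (hi : ∀ k, 0 ≤ i k) (hx : ∀ k, 0 < x k)
    {τ m : ℝ} (hτ : HasCesaroMean (sojourn w₀ i x) τ) (hm : HasCesaroMean i m) :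
    HasPeakAge w₀ a₀ i x (τ + m) := by
  have hmean : HasCesaroMean (fun k => sojourn w₀ i x (k + 1) + i k) (τ + m) :=
    (HasCesaroMean.comp_succ_iff.2 hτ).add hm
  have hpeak : HasCesaroMean (peak w₀ a₀ i x) (τ + m) := by
    rw [← HasCesaroMean.comp_succ_iff] at hmean ⊢
    simpa only [peak_succ ha₀ hi hx] using hmean
  simpa only [HasPeakAge, HasCesaroMean, one_div_mul_eq_div] using hpeak

lemma tendsto_departure_div_natCast {τ m : ℝ} (hτ : HasCesaroMean (sojourn w₀ i x) τ)
    (hm : HasCesaroMean i m) : Tendsto (fun n : ℕ => departure w₀ i x n / n) atTop (𝓝 m) := by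
  have hadd := (tendsto_succ_div_natCast_iff.2 hm).add
    (tendsto_succ_div_natCast_iff.2 hτ.tendsto_div_natCast)
  simpa only [departure_eq, arrival, add_div, add_zero] using hadd

lemma hasAverageAge_of_hasCesaroMean (ha₀ : 0 ≤ a₀) (hi : ∀ k, 0 ≤ i k) (hx : ∀ k, 0 ≤ x k)
    {τ m β : ℝ} (hm₀ : 0 < m) (hτ : HasCesaroMean (sojourn w₀ i x) τ) (hm : HasCesaroMean i m)
    (hβ : HasCesaroMean (fun k => ageArea (sojourn w₀ i x k) (i k, x k)) β) :
    HasAverageAge w₀ a₀ i x (β / m) := by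
  have hD := tendsto_departure_div_natCast hτ hm
  have hint (T : ℝ) (hT : 0 ≤ T) : IntervalIntegrable (age w₀ a₀ i x) volume 0 T := by
    obtain ⟨n, hn⟩ :=
      ((tendsto_atTop_of_tendsto_div_natCast hm₀ hD).eventually_ge_atTop T).exists
    refine (intervalIntegrable_age_departure ha₀ hi hx n).mono_set ?_
    rw [Set.uIcc_of_le hT, Set.uIcc_of_le (hT.trans hn)]
    exact Set.Icc_subset_Icc_right hn
  have hmono : MonotoneOn (fun T => ∫ t in (0 : ℝ)..T, age w₀ a₀ i x t) (Set.Ici 0) :=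
    fun S hS T hT hST => intervalIntegral.integral_mono_interval le_rfl hS hST
      ((ae_restrict_iff' measurableSet_Ioc).2 (ae_of_all _ fun t ht => age_nonneg ha₀ hx ht.1.le))
      (hint T hT)
  have hepochs : Tendsto (fun n : ℕ => (∫ t in (0 : ℝ)..(departure w₀ i x n),
      age w₀ a₀ i x t) / n) atTop (𝓝 β) := by
    have hadd := (tendsto_const_div_atTop_nhds_zero_nat
      (∫ t in (0 : ℝ)..(departure w₀ i x 0), age w₀ a₀ i x t)).add
      (HasCesaroMean.comp_succ_iff.2 hβ)
    rw [zero_add] at hadd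
    exact hadd.congr fun n => by rw [integral_age_departure ha₀ hi hx n, add_div]
  refine ⟨hint, ?_⟩
  simpa only [one_div_mul_eq_div] using
    tendsto_div_of_tendsto_epochs hm₀ intervalIntegral.integral_same.ge hmono hD hepochs

end SamplePath

section StableQueue

variable {ν : Measure (ℝ × ℝ)} [IsProbabilityMeasure ν]

lemma IsStableLaw.ae_hasCesaroMean_sojourn (hν : IsStableLaw ν) :
    ∀ᵐ ω ∂(iidLaw ν), ∀ w₀, HasCesaroMean (sojourn w₀ (fun k => (ω k).1) fun k => (ω k).2)
      (∫ u, u ∂(stationaryLaw ν)) := by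
  have hmean := ae_forall_hasCesaroMean_drivenOrbit hν.measurePreserving_sojournStep
    hν.ae_coalesces (hν.integrable_stationaryLaw.comp_fst ν)
  rwa [integral_fun_fst (fun u : ℝ => u), probReal_univ, one_smul] at hmean

lemma IsStableLaw.ae_hasPeakAge (hν : IsStableLaw ν) (hpos : ∀ᵐ e ∂ν, 0 < e.2) :
    ∀ᵐ ω ∂(iidLaw ν), ∀ w₀ a₀, 0 ≤ a₀ →
      HasPeakAge w₀ a₀ (fun k => (ω k).1) (fun k => (ω k).2)
        ((∫ u, u ∂(stationaryLaw ν)) + ∫ e, e.1 ∂ν) := by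
  have hservice : ∀ᵐ ω ∂(iidLaw ν), ∀ k, 0 < (ω k).2 := ae_all_iff.2 fun k =>
    (measurePreserving_eval_iidLaw ν k).quasiMeasurePreserving.ae hpos
  filter_upwards [hν.ae_nonneg, hservice, hν.ae_hasCesaroMean_sojourn,
    ae_hasCesaroMean_iidLaw ν hν.integrable_fst] with ω hω hx hτ hm w₀ a₀ ha₀
  exact hasPeakAge_of_hasCesaroMean ha₀ (fun k => (hω k).1) hx (hτ w₀) hm

lemma IsStableLaw.ae_hasAverageAge (hν : IsStableLaw ν) :
    ∀ᵐ ω ∂(iidLaw ν), ∀ w₀ a₀, 0 ≤ a₀ →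
      HasAverageAge w₀ a₀ (fun k => (ω k).1) (fun k => (ω k).2)
        ((∫ p, ageArea p.1 p.2 ∂((stationaryLaw ν).prod ν)) / ∫ e, e.1 ∂ν) := by
  filter_upwards [hν.ae_nonneg, hν.ae_hasCesaroMean_sojourn,
    ae_hasCesaroMean_iidLaw ν hν.integrable_fst,
    ae_forall_hasCesaroMean_drivenOrbit hν.measurePreserving_sojournStep hν.ae_coalesces
      hν.integrable_ageArea] with ω hω hτ hm hβ w₀ a₀ ha₀
  exact hasAverageAge_of_hasCesaroMean ha₀ (fun k => (hω k).1) (fun k => (hω k).2)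
    hν.integral_fst_pos (hτ w₀) hm (hβ w₀)

lemma IsStableLaw.abs_averageAge_sub_le (hν : IsStableLaw ν) :
    |(∫ p, ageArea p.1 p.2 ∂((stationaryLaw ν).prod ν)) / ∫ e, e.1 ∂ν
      - ((∫ u, u ∂(stationaryLaw ν)) + (∫ e, e.1 * e.2 ∂ν) / ∫ e, e.1 ∂ν)| ≤
      (∫ e, e.1 ^ 2 ∂ν) / (2 * ∫ e, e.1 ∂ν) := by
  have hm := hν.integral_fst_pos
  rw [← div_div, ← mul_div_cancel_right₀ (∫ u, u ∂(stationaryLaw ν)) hm.ne', ← add_div, ← sub_div,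
    abs_div, abs_of_pos hm]
  gcongr
  exact hν.abs_integral_ageArea_sub_le

end StableQueue

section Input

variable {Ω : Type*} [MeasurableSpace Ω] {μ : Measure Ω}

lemma isStableLaw_map {U V : Ω → ℝ} (hU : ∀ᵐ ω ∂μ, 0 ≤ U ω) (hV : ∀ᵐ ω ∂μ, 0 ≤ V ω)
    (hU2 : MemLp U 2 μ) (hV2 : MemLp V 2 μ) (hlt : ∫ ω, V ω ∂μ < ∫ ω, U ω ∂μ) :
    IsStableLaw (μ.map fun ω => (U ω, V ω)) := by
  have hpair := hU2.aestronglyMeasurable.aemeasurable.prodMk hV2.aestronglyMeasurable.aemeasurable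
  refine ⟨(ae_map_iff hpair (measurableSet_le measurable_const measurable_fst)).2 hU,
    (ae_map_iff hpair (measurableSet_le measurable_const measurable_snd)).2 hV,
    (memLp_map_measure_iff (by fun_prop) hpair).2 hU2,
    (memLp_map_measure_iff (by fun_prop) hpair).2 hV2, ?_⟩
  rwa [integral_map hpair (by fun_prop), integral_map hpair (by fun_prop)]

variable {I X : ℕ → Ω → ℝ}

lemma IsInput.iIndepFun_prodMk (h : IsInput μ I X) : iIndepFun (fun k ω => (I k ω, X k ω)) μ :=
  iIndepFun_prodMk_of_iIndepFun_sumElim h.measurable_interarrival h.measurable_service h.indep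

lemma IsInput.indepFun (h : IsInput μ I X) (k : ℕ) : IndepFun (I k) (X k) μ :=
  h.indep.indepFun Sum.inl_ne_inr

lemma IsInput.identDistrib_prodMk (h : IsInput μ I X) (k : ℕ) :
    IdentDistrib (fun ω => (I k ω, X k ω)) (fun ω => (I 0 ω, X 0 ω)) μ μ :=
  have := h.indep.isProbabilityMeasure
  (h.ident_interarrival k).prodMk (h.ident_service k) (h.indepFun k) (h.indepFun 0)

lemma IsInput.integral_mul (h : IsInput μ I X) :
    ∫ ω, I 0 ω * X 0 ω ∂μ = (∫ ω, I 0 ω ∂μ) * ∫ ω, X 0 ω ∂μ :=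
  (h.indepFun 0).integral_fun_mul_eq_mul_integral
    (h.measurable_interarrival 0).aestronglyMeasurable
    (h.measurable_service 0).aestronglyMeasurable

end Input

lemma le_and_le_of_abs_sub_le {Aav Ap m b s : ℝ} (hm : 0 < m) (hb : 0 ≤ b) (hbm : b ≤ m)
    (hs : 0 ≤ s) (h : |Aav - (Ap - m + b)| ≤ s / (2 * m)) :
    Ap - 3 * (1 / m) * s / 2 - 1 / m * m ^ 2 ≤ Aav ∧ Aav ≤ Ap + 1 / m * s / 2 := by
  have hS : 0 ≤ s / (2 * m) := by positivity
  rw [show 3 * (1 / m) * s / 2 = 3 * (s / (2 * m)) by field_simp,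
    show 1 / m * m ^ 2 = m by field_simp, show 1 / m * s / 2 = s / (2 * m) by field_simp]
  obtain ⟨hlower, hupper⟩ := abs_le.1 h
  constructor <;> linarith

end GG1

theorem mainTheorem7_general {Ω : Type*} [MeasurableSpace Ω] {μ : Measure Ω} {I X : ℕ → Ω → ℝ}
    (hindep : iIndepFun (fun k ω => (I k ω, X k ω)) μ)
    (hident : ∀ k, IdentDistrib (fun ω => (I k ω, X k ω)) (fun ω => (I 0 ω, X 0 ω)) μ μ)
    (hI : ∀ᵐ ω ∂μ, 0 ≤ I 0 ω) (hX : ∀ᵐ ω ∂μ, 0 < X 0 ω)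
    (hI2 : MemLp (I 0) 2 μ) (hX2 : MemLp (X 0) 2 μ)
    (hstable : ∫ ω, X 0 ω ∂μ < ∫ ω, I 0 ω ∂μ) :
    ∃ Aav Ap : ℝ,
      (∀ᵐ ω ∂μ, ∀ w₀ a₀, 0 ≤ a₀ →
        GG1.HasAverageAge w₀ a₀ (fun k => I k ω) (fun k => X k ω) Aav) ∧
      (∀ᵐ ω ∂μ, ∀ w₀ a₀, 0 ≤ a₀ →
        GG1.HasPeakAge w₀ a₀ (fun k => I k ω) (fun k => X k ω) Ap) ∧
      |Aav - (Ap - ∫ ω, I 0 ω ∂μ + (∫ ω, I 0 ω * X 0 ω ∂μ) / ∫ ω, I 0 ω ∂μ)| ≤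
        (∫ ω, I 0 ω ^ 2 ∂μ) / (2 * ∫ ω, I 0 ω ∂μ) := by
  have := hindep.isProbabilityMeasure
  have hpair := (hident 0).aemeasurable_snd
  have := Measure.isProbabilityMeasure_map (μ := μ) hpair
  have hν := GG1.isStableLaw_map hI (hX.mono fun _ => le_of_lt) hI2 hX2 hstable
  have hpos := (ae_map_iff hpair (measurableSet_lt measurable_const measurable_snd)).2 hX
  have hseq := hasLaw_iidLaw hindep hident
  have hav := ae_of_ae_map hseq.aemeasurable (by rw [hseq.map_eq]; exact hν.ae_hasAverageAge)
  have hp := ae_of_ae_map hseq.aemeasurable (by rw [hseq.map_eq]; exact hν.ae_hasPeakAge hpos)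
  have hbound := hν.abs_averageAge_sub_le
  rw [← add_sub_cancel_right (∫ u, u ∂(GG1.stationaryLaw _)) (∫ ω, I 0 ω ∂μ),
    integral_map hpair (f := fun e => e.1 * e.2) (by fun_prop),
    integral_map hpair (f := fun e => e.1 ^ 2) (by fun_prop)] at hbound
  rw [integral_map hpair (f := fun e => e.1) (by fun_prop)] at hav hp hbound
  exact ⟨_, _, hav, hp, hbound⟩

theorem mainTheorem7 {Ω : Type*} [MeasurableSpace Ω] (μ : Measure Ω) [IsProbabilityMeasure μ]
    (I X : ℕ → Ω → ℝ) (hIX : GG1.IsInput μ I X)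
    (hI2 : MemLp (I 0) 2 μ) (hX2 : MemLp (X 0) 2 μ)
    (hstable : ∫ ω, X 0 ω ∂μ < ∫ ω, I 0 ω ∂μ)
    (w₀ a₀ : Ω → ℝ) (hw₀ : ∀ ω, 0 ≤ w₀ ω) (ha₀ : ∀ ω, 0 ≤ a₀ ω)
    (lam : ℝ) (hlam : lam = 1 / ∫ ω, I 0 ω ∂μ) :
    ∃ Aav Ap : ℝ,
      (∀ᵐ ω ∂μ, GG1.HasAverageAge (w₀ ω) (a₀ ω) (fun k => I k ω) (fun k => X k ω) Aav) ∧
      (∀ᵐ ω ∂μ, GG1.HasPeakAge (w₀ ω) (a₀ ω) (fun k => I k ω) (fun k => X k ω) Ap) ∧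
      Ap - 3 * lam * (∫ ω, (I 0 ω) ^ 2 ∂μ) / 2 - lam * (∫ ω, I 0 ω ∂μ) ^ 2 ≤ Aav ∧
      Aav ≤ Ap + lam * (∫ ω, (I 0 ω) ^ 2 ∂μ) / 2 := by
  have hEX : 0 ≤ ∫ ω, X 0 ω ∂μ := integral_nonneg_of_ae (hIX.service_pos.mono fun _ => le_of_lt)
  have hEI : 0 < ∫ ω, I 0 ω ∂μ := hEX.trans_lt hstable
  obtain ⟨Aav, Ap, hav, hp, hbound⟩ := mainTheorem7_general
    hIX.iIndepFun_prodMk hIX.identDistrib_prodMk (hIX.interarrival_pos.mono fun _ => le_of_lt)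
    hIX.service_pos hI2 hX2 hstable
  rw [hIX.integral_mul, mul_div_cancel_left₀ _ hEI.ne'] at hbound
  exact ⟨Aav, Ap, hav.mono fun ω h => h _ _ (ha₀ ω), hp.mono fun ω h => h _ _ (ha₀ ω),
    hlam ▸ GG1.le_and_le_of_abs_sub_le hEI hEX hstable.le
      (integral_nonneg fun ω => sq_nonneg (I 0 ω)) hbound⟩
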